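/- Let $K$ be a symmetric, continuous, positive-definite (i.e. $\sum_{a,b} c_a c_b K(x_a,x_b)\ge 0$) kernel on $\mathbb R^p$ with reproducing kernel Hilbert space $H=\mathcal H(K)$, inner product $\langle\cdot,\cdot\rangle$ and norm $\|\cdot\|$. Let $(Y_i)_{i\in\mathbb Z}$ be a strictly stationary $\mathbb R^p$-valued process. Let $P_0$ be a probability measure on $\mathbb R^p$ that has a mean embedding $\mu_{P_0}\in H$, i.e. every $f\in H$ is $P_0$-integrable and $\langle f,\mu_{P_0}\rangle=\int f\,dP_0$. Put $X_i=K(Y_i,\cdot)-\mu_{P_0}\in H$. Suppose that the null hypothesis $H_0$ holds: the marginal distribution of $Y_1$ is $P_0$. Let $D_H[0,1]$ be the space of cadlag functions $[0,1]\to H$ with the Skorokhod topology, given by the metric $\rho(f,g)=\inf_{\lambda}\{\sup_t\|f(t)-g(\lambda(t))\|+\sup_t|t-\lambda(t)|\}$, where $\lambda$ ranges over the strictly increasing continuous maps of $[0,1]$ onto itself. Assume the functional central limit theorem $$\Big(\tfrac1{\sqrt n}\sum_{i=1}^{\lfloor nt\rfloor}X_i\Big)_{t\in[0,1]}\leadsto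 (W(t))_{t\in[0,1]}\quad\text{in } D_H[0,1],$$ where $W$ is a Brownian motion in $H$ with covariance operator $S$: almost surely $W(0)=0$ and $W$ is continuous, the increments of $W$ on disjoint intervals are independent, and for $s\le t$ the increment $W(t)-W(s)$ is Gaussian with mean zero and covariance operator $(t-s)S$. Here $S$ is the bounded linear operator on $H$ given by $$\langle Sx,y\rangle=\sum_{i=-\infty}^{\infty}\mathbb E\big[\langle X_0,x\rangle\langle X_i,y\rangle\big],\qquad x,y\in H,$$ where all the expectations exist and the series converges absolutely. Assume moreover that the limit is nondegenerate, $S\neq 0$. Fix $\eta\in(0,1)$ and let $m_1=\lfloor n\eta\rfloor$, $m_2=n-m_1$, $\hat\mu_1=\frac1{m_1}\sum_{i=1}^{m_1}X_i$, $Z_i=\langle\hat\mu_1,X_{m_1+i}\rangle$ for $1\le i\le m_2$, and $$T_n=\frac1{m_2}\sum_{i=1}^{m_2}Z_i,\qquad W_n=\sqrt{\frac1{m_2^2}\sum_{t=1}^{m_2}\Big(\sum_{j=1}^tZ_j-t\,T_n\Big)^2},\qquad U_n=\frac{T_n}{W_n},$$ with the convention that a quotient with denominator $0$ is $0$. Then,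 as $n\to\infty$, $$\sqrt{m_2}\,U_n\ \overset{D}{\to}\ U:=\frac{B(1)}{\sqrt{\int_0^1\big(B(s)-sB(1)\big)^2\,ds}},$$ where $B$ is a standard Brownian motion on $[0,1]$. In particular the limit law is pivotal and does not depend on $\eta$. -/

import Mathlib

open MeasureTheory ProbabilityTheory Filter Topology unitInterval
open scoped ENNReal RealInnerProductSpace

noncomputable section

/-! ### The Skorokhod space of `H`-valued cadlag functions on `[0,1]` -/

/-- `D_H[0,1]`: the functions `[0,1] → H` that are right continuous and have left limits at all
points. -/
structure SkorokhodSpace (H : Type*) [TopologicalSpace H] where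
  toFun : I → H
  right_continuous : ∀ t, ContinuousWithinAt toFun (Set.Ici t) t
  left_limit : ∀ t, ∃ l, Tendsto toFun (𝓝[<] t) (𝓝 l)

namespace SkorokhodSpace

instance instCoeFun {H : Type*} [TopologicalSpace H] :
    CoeFun (SkorokhodSpace H) (fun _ => I → H) := ⟨toFun⟩

/-- The cost `sup_t ‖f t - g (l t)‖ + sup_t |t - l t|` of a change of time `l`. -/
def cost {H : Type*} [PseudoEMetricSpace H] (f g : SkorokhodSpace H) (l : I ≃o I) : ℝ≥0∞ :=
  (⨆ t, edist (f t) (g (l t))) + ⨆ t, edist t (l t)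

/-- The Skorokhod metric
`ρ(f, g) = inf_l {sup_t ‖f t - g (l t)‖ + sup_t |t - l t|}`, where `l` ranges over the strictly
increasing continuous maps of `[0,1]` onto itself, that is, over the order isomorphisms of `[0,1]`.
It induces the topology of `D_H[0,1]`. -/
instance instPseudoEMetricSpace {H : Type*} [PseudoEMetricSpace H] :
    PseudoEMetricSpace (SkorokhodSpace H) where
  edist f g := ⨅ l : I ≃o I, cost f g l
  edist_self f := by
    refine le_antisymm (iInf_le_of_le (OrderIso.refl I) ?_) bot_le
    simp [cost]
  edist_comm := by
    have key : ∀ f g : SkorokhodSpace H,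
        (⨅ l : I ≃o I, cost f g l) ≤ ⨅ l : I ≃o I, cost g f l := by
      intro f g
      refine le_iInf fun l => iInf_le_of_le l.symm ?_
      refine add_le_add (iSup_le fun t => ?_) (iSup_le fun t => ?_)
      · refine le_trans (le_of_eq ?_) (le_iSup (fun t => edist (g t) (f (l t))) (l.symm t))
        simp [edist_comm]
      · refine le_trans (le_of_eq ?_) (le_iSup (fun t => edist t (l t)) (l.symm t))
        simp [edist_comm]
    exact fun f g => le_antisymm (key f g) (key g f)
  edist_triangle f g h := by
    rw [ENNReal.iInf_add]
    refine le_iInf fun a => ?_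
    rw [ENNReal.add_iInf]
    refine le_iInf fun b => iInf_le_of_le (a.trans b) ?_
    have h1 : (⨆ t, edist (f t) (h ((a.trans b) t)))
        ≤ (⨆ t, edist (f t) (g (a t))) + ⨆ t, edist (g t) (h (b t)) :=
      iSup_le fun t => (edist_triangle _ (g (a t)) _).trans
        (add_le_add (le_iSup (fun t => edist (f t) (g (a t))) t)
          (le_iSup (fun t => edist (g t) (h (b t))) (a t)))
    have h2 : (⨆ t, edist t ((a.trans b) t))
        ≤ (⨆ t, edist t (a t)) + ⨆ t, edist t (b t) :=
      iSup_le fun t => (edist_triangle _ (a t) _).trans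
        (add_le_add (le_iSup (fun t => edist t (a t)) t)
          (le_iSup (fun t => edist t (b t)) (a t)))
    calc cost f h (a.trans b) ≤ _ := add_le_add h1 h2
      _ = cost f g a + cost g h b := by unfold cost; exact add_add_add_comm _ _ _ _

instance instMeasurableSpace {H : Type*} [PseudoEMetricSpace H] :
    MeasurableSpace (SkorokhodSpace H) := borel _

instance instBorelSpace {H : Type*} [PseudoEMetricSpace H] :
    BorelSpace (SkorokhodSpace H) := ⟨rfl⟩

end SkorokhodSpace

/-- The normalized partial sum path `t ↦ n^{-1/2} ∑_{i=1}^{⌊n t⌋} X i`, an element of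
`D_H[0,1]`. -/
def partialSumPath {H : Type*} [NormedAddCommGroup H] [NormedSpace ℝ H] (X : ℤ → H) (n : ℕ) :
    SkorokhodSpace H where
  toFun t := (√(n : ℝ))⁻¹ • ∑ i ∈ Finset.Icc 1 ⌊(n : ℝ) * (t : ℝ)⌋₊, X (i : ℤ)
  right_continuous t := by
    have hc : Tendsto (fun s : I => (n : ℝ) * (s : ℝ)) (𝓝[≥] t) (𝓝[≥] ((n : ℝ) * (t : ℝ))) := by
      refine tendsto_nhdsWithin_iff.2 ⟨?_, ?_⟩
      · exact ((continuous_const.mul continuous_subtype_val).tendsto t).mono_left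
          nhdsWithin_le_nhds
      · filter_upwards [self_mem_nhdsWithin] with s hs
        have hs' : (t : ℝ) ≤ (s : ℝ) := hs
        exact mul_le_mul_of_nonneg_left hs' (Nat.cast_nonneg n)
    have hf := tendsto_pure.1 ((tendsto_floor_right_pure_floor ((n : ℝ) * (t : ℝ))).comp hc)
    refine Tendsto.congr' ?_ tendsto_const_nhds
    filter_upwards [hf] with s hs
    simp only [Function.comp] at hs
    rw [← Int.floor_toNat, ← Int.floor_toNat, hs]
  left_limit t := by
    rcases Nat.eq_zero_or_pos n with hn | hn
    · exact ⟨0, by simpa [hn] using tendsto_const_nhds⟩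
    have hc : Tendsto (fun s : I => (n : ℝ) * (s : ℝ)) (𝓝[<] t) (𝓝[<] ((n : ℝ) * (t : ℝ))) := by
      refine tendsto_nhdsWithin_iff.2 ⟨?_, ?_⟩
      · exact ((continuous_const.mul continuous_subtype_val).tendsto t).mono_left
          nhdsWithin_le_nhds
      · filter_upwards [self_mem_nhdsWithin] with s hs
        have hs' : (s : ℝ) < (t : ℝ) := hs
        exact mul_lt_mul_of_pos_left hs' (Nat.cast_pos.2 hn)
    have hf := tendsto_pure.1 ((tendsto_floor_left_pure_ceil_sub_one ((n : ℝ) * (t : ℝ))).comp hc)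
    refine ⟨(√(n : ℝ))⁻¹ •
      ∑ i ∈ Finset.Icc 1 (⌈(n : ℝ) * (t : ℝ)⌉ - 1).toNat, X (i : ℤ), ?_⟩
    refine Tendsto.congr' ?_ tendsto_const_nhds
    filter_upwards [hf] with s hs
    simp only [Function.comp] at hs
    rw [← Int.floor_toNat, hs]

/-! ### Stochastic processes -/

/-- A (strictly) stationary process: all time shifts have the same law. -/
def IsStationaryProcess {Ω E : Type*} [MeasurableSpace Ω] [MeasurableSpace E]
    (Y : ℤ → Ω → E) (Pr : Measure Ω) : Prop :=
  ∀ k : ℤ, IdentDistrib (fun ω i => Y (i + k) ω) (fun ω i => Y i ω) Pr Pr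

/-- `W` is a Brownian motion on `[0,1]` in the Hilbert space `H`, with covariance operator `S`:
it starts at `0` and has continuous paths almost surely, its increments on disjoint intervals are
independent, and `W t - W s` is Gaussian with mean zero and covariance operator `(t - s) S`. -/
structure IsBrownianMotion {Ω H : Type*} [MeasurableSpace Ω]
    [NormedAddCommGroup H] [InnerProductSpace ℝ H] [MeasurableSpace H]
    (W : I → Ω → H) (S : H →L[ℝ] H) (Pr : Measure Ω) : Prop where
  measurable : ∀ t, Measurable (W t)
  zero : ∀ᵐ ω ∂Pr, W 0 ω = 0
  continuous : ∀ᵐ ω ∂Pr, Continuous fun t => W t ω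
  indep_increments : HasIndepIncrements W Pr
  gaussian : ∀ s t, s ≤ t → HasGaussianLaw (fun ω => W t ω - W s ω) Pr
  mean : ∀ s t, s ≤ t → ∀ h : H, ∫ ω, ⟪W t ω - W s ω, h⟫ ∂Pr = 0
  covariance : ∀ s t, s ≤ t → ∀ h₁ h₂ : H,
    ∫ ω, ⟪W t ω - W s ω, h₁⟫ * ⟪W t ω - W s ω, h₂⟫ ∂Pr = ((t : ℝ) - (s : ℝ)) * ⟪S h₁, h₂⟫

/-- A standard (real) Brownian motion on `[0,1]`. -/
def IsStandardBrownianMotion {Ω : Type*} [MeasurableSpace Ω] (B : I → Ω → ℝ) (Pr : Measure Ω) :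
    Prop :=
  IsBrownianMotion B (ContinuousLinearMap.id ℝ ℝ) Pr

/-- The random variable `U = B(1) / √(∫₀¹ (B(s) - s B(1))² ds)`. -/
def limitU {Ω : Type*} (B : I → Ω → ℝ) (ω : Ω) : ℝ :=
  B 1 ω / √(∫ s : I, (B s ω - (s : ℝ) * B 1 ω) ^ 2)

/-! ### Kernels and mean embeddings -/

/-- A symmetric, continuous, positive-definite kernel. -/
structure IsContinuousPDKernel {E : Type*} [TopologicalSpace E] (K : E → E → ℝ) : Prop where
  symm : ∀ x y, K x y = K y x
  continuous : Continuous fun z : E × E => K z.1 z.2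
  posDef : ∀ (s : Finset E) (c : E → ℝ), 0 ≤ ∑ x ∈ s, ∑ y ∈ s, c x * c y * K x y

/-- The Hilbert function space `H` is the reproducing kernel Hilbert space of `K`. -/
def IsRKHSOf {E : Type*} (H : Type*) [NormedAddCommGroup H] [InnerProductSpace ℝ H]
    [CompleteSpace H] [RKHS ℝ H E ℝ] (K : E → E → ℝ) : Prop :=
  ∀ x y, RKHS.kernel H x y 1 = K x y

/-- The element `K(x, ·)` of the reproducing kernel Hilbert space `H`. -/
def kernelSection {E : Type*} (H : Type*) [NormedAddCommGroup H] [InnerProductSpace ℝ H]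
    [CompleteSpace H] [RKHS ℝ H E ℝ] (x : E) : H :=
  RKHS.kerFun H x 1

/-- `m` is the mean embedding of `Q` into `H`: `⟪f, m⟫ = E_{X ∼ Q} f(X)` for all `f` in `H`. -/
def IsMeanEmbedding {E H : Type*} [MeasurableSpace E] [NormedAddCommGroup H]
    [InnerProductSpace ℝ H] [RKHS ℝ H E ℝ] (Q : Measure E) (m : H) : Prop :=
  ∀ f : H, Integrable (fun x => f x) Q ∧ ⟪f, m⟫ = ∫ x, f x ∂Q

/-- The centered embedded series `X_i = K(Y_i, ·) - m`. -/
def embedded {E Ω H : Type*} [NormedAddCommGroup H] [InnerProductSpace ℝ H]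
    [CompleteSpace H] [RKHS ℝ H E ℝ] (Y : ℤ → Ω → E) (m : H) (ω : Ω) (i : ℤ) : H :=
  kernelSection H (Y i ω) - m

/-- The functional central limit theorem for the embedded series in `D_H[0,1]`: the normalized
partial sums of `K(Y_i, ·) - m` converge weakly to the Brownian motion `W` whose covariance
operator `S` is the (absolutely convergent) sum of the autocovariances of the series. -/
structure SatisfiesFCLT {E Ω Ω' H : Type*} [MeasurableSpace Ω] [MeasurableSpace Ω']
    [NormedAddCommGroup H] [InnerProductSpace ℝ H] [CompleteSpace H] [MeasurableSpace H]
    [RKHS ℝ H E ℝ] (Y : ℤ → Ω → E) (m : H) (Pr : Measure Ω) [IsProbabilityMeasure Pr]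
    (W : Ω' → SkorokhodSpace H) (S : H →L[ℝ] H) (Pr' : Measure Ω') [IsProbabilityMeasure Pr'] :
    Prop where
  integrable : ∀ (x y : H) (i : ℤ),
    Integrable (fun ω => ⟪embedded Y m ω 0, x⟫ * ⟪embedded Y m ω i, y⟫) Pr
  summable : ∀ x y : H,
    Summable fun i : ℤ => |∫ ω, ⟪embedded Y m ω 0, x⟫ * ⟪embedded Y m ω i, y⟫ ∂Pr|
  covariance : ∀ x y : H,
    ⟪S x, y⟫ = ∑' i : ℤ, ∫ ω, ⟪embedded Y m ω 0, x⟫ * ⟪embedded Y m ω i, y⟫ ∂Pr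
  measurable : Measurable W
  brownian : IsBrownianMotion (fun t ω' => W ω' t) S Pr'
  tendsto : TendstoInDistribution (fun (n : ℕ) ω => partialSumPath (embedded Y m ω) n) atTop W
    (fun _ => Pr) Pr'

/-! ### The test statistic

Below, `X` is the (realized) embedded series, `η` the splitting ratio and `n` the sample size. -/

section Statistic

/-- `m₁ = ⌊n η⌋`. -/
def size₁ (η : ℝ) (n : ℕ) : ℕ := ⌊(n : ℝ) * η⌋₊

/-- `m₂ = n - m₁` (no truncation takes place for `0 < η < 1`). -/
def size₂ (η : ℝ) (n : ℕ) : ℕ := n - size₁ η n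

/-- The sample mean `μ̂₁` of the first subsample. -/
def muHat₁ {H : Type*} [NormedAddCommGroup H] [InnerProductSpace ℝ H]
    (X : ℤ → H) (η : ℝ) (n : ℕ) : H :=
  (size₁ η n : ℝ)⁻¹ • ∑ i ∈ Finset.Icc 1 (size₁ η n), X (i : ℤ)

/-- The projections `Z_i = ⟪μ̂₁, X_{m₁ + i}⟫`. -/
def projZ {H : Type*} [NormedAddCommGroup H] [InnerProductSpace ℝ H]
    (X : ℤ → H) (η : ℝ) (n : ℕ) (i : ℕ) : ℝ :=
  ⟪muHat₁ X η n, X ((size₁ η n + i : ℕ) : ℤ)⟫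

/-- `T_n = m₂⁻¹ ∑_{i=1}^{m₂} Z_i`. -/
def statT {H : Type*} [NormedAddCommGroup H] [InnerProductSpace ℝ H]
    (X : ℤ → H) (η : ℝ) (n : ℕ) : ℝ :=
  (size₂ η n : ℝ)⁻¹ * ∑ i ∈ Finset.Icc 1 (size₂ η n), projZ X η n i

/-- The self-normalizer `W_n = √(m₂⁻² ∑_{t=1}^{m₂} (∑_{j=1}^t Z_j - t T_n)²)`. -/
def selfNormalizer {H : Type*} [NormedAddCommGroup H] [InnerProductSpace ℝ H]
    (X : ℤ → H) (η : ℝ) (n : ℕ) : ℝ :=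
  √(((size₂ η n : ℝ) ^ 2)⁻¹ * ∑ t ∈ Finset.Icc 1 (size₂ η n),
    (∑ j ∈ Finset.Icc 1 t, projZ X η n j - (t : ℝ) * statT X η n) ^ 2)

/-- The self-normalized statistic `U_n = T_n / W_n`. -/
def statU {H : Type*} [NormedAddCommGroup H] [InnerProductSpace ℝ H]
    (X : ℤ → H) (η : ℝ) (n : ℕ) : ℝ :=
  statT X η n / selfNormalizer X η n

end Statistic

end

noncomputable section

/-! Let V be the normalized partial sum path. The partial sums of the Z_j are, up to the factor
n/m₁, the inner products of V(η) with increments of V after time η. This factor cancels in T_n /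
W_n, so √m₂ U_n is a self-normalized ratio evaluated on V (`sqrt_size₂_mul_statU`). Near a
continuous path Skorokhod convergence is uniform, and the sum in the denominator is a Riemann sum.
The FCLT and an extended continuous mapping theorem (`TendstoInDistribution.comp_of_tendsto`)
therefore give the limit `selfNormPath` of A(s) = ⟪W(η), W(η + (1-η)s) - W(η)⟫, provided its
denominator is almost surely nonzero.

Given W(η) = h, independence of increments makes A a real Brownian motion with variance parameter
(1-η)⟪Sh, h⟫, which is almost surely positive because S ≠ 0 (`ae_inner_pos`). The ratio ignores
positive scale factors, so its law is that of U whatever h and η are.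

Conditioning is only carried out in finite dimension. On each regular grid, A and B give the same
Gaussian probability to every scale-invariant event of increments (`HasScaledBrownianIncrements`).
The discretized ratios thus share one law and converge almost surely to the two path ratios;
uniqueness of weak limits identifies the laws (`map_selfNormPath_eq`). -/

/-! ### Riemann sums on the unit interval. -/

/-- The point `x` of `[0,1]`, clamped to the interval. -/
def clampI (x : ℝ) : I := Set.projIcc 0 1 zero_le_one x

lemma coe_clampI {x : ℝ} (h0 : 0 ≤ x) (h1 : x ≤ 1) : (clampI x : ℝ) = x := by
  simp [clampI, Set.projIcc_of_mem zero_le_one (show x ∈ Set.Icc (0 : ℝ) 1 from ⟨h0, h1⟩)]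

lemma clampI_coe (s : I) : clampI s = s := Set.projIcc_val zero_le_one s

lemma clampI_one : clampI 1 = 1 := clampI_coe 1

lemma clampI_zero : clampI 0 = 0 := clampI_coe 0

lemma clampI_div (t N : ℕ) (h : t ≤ N) : (clampI (t / N : ℝ) : ℝ) = t / N :=
  coe_clampI (by positivity) (div_le_one_of_le₀ (by exact_mod_cast h) (by positivity))

lemma continuous_clampI : Continuous clampI := continuous_projIcc (h := zero_le_one)

lemma monotone_clampI : Monotone clampI := Set.monotone_projIcc zero_le_one

lemma dist_clampI_le (x y : ℝ) : dist (clampI x) (clampI y) ≤ |x - y| := by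
  rw [Subtype.dist_eq, Real.dist_eq]
  exact Set.abs_projIcc_sub_projIcc zero_le_one

lemma integral_unitInterval_eq (q : I → ℝ) :
    ∫ s : I, q s = ∫ x in (0 : ℝ)..1, q (clampI x) := by
  rw [intervalIntegral.integral_of_le zero_le_one, ← integral_Icc_eq_integral_Ioc]
  rw [← integral_subtype_comap measurableSet_Icc (fun x => q (clampI x))]
  refine integral_congr_ae (.of_forall fun s => ?_)
  simp [clampI_coe]

/-- Convergence of perturbed Riemann sums, along an arbitrary filter. -/
lemma tendsto_riemannSum {ι : Type*} {l : Filter ι} {q : I → ℝ} (hq : Continuous q)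
    {N : ι → ℕ} (hN : Tendsto N l atTop) {D : ι → ℕ → ℝ}
    (hD : ∀ ε > 0, ∀ᶠ i in l, ∀ t ≤ N i, |D i t - q (clampI (t / N i))| ≤ ε) :
    Tendsto (fun i => (N i : ℝ)⁻¹ * ∑ t ∈ Finset.Icc 1 (N i), D i t) l (𝓝 (∫ s : I, q s)) := by
  rw [Metric.tendsto_nhds]
  intro ε hε
  have hqu : UniformContinuous q := CompactSpace.uniformContinuous_of_continuous hq
  obtain ⟨δ, hδ, hqδ⟩ := Metric.uniformContinuous_iff.1 hqu (ε / 4) (by positivity)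
  have hN' : Tendsto (fun i => ((N i : ℝ))⁻¹) l (𝓝 0) :=
    tendsto_inv_atTop_zero.comp (tendsto_natCast_atTop_atTop.comp hN)
  filter_upwards [hD (ε / 4) (by positivity), hN'.eventually (gt_mem_nhds hδ),
    hN.eventually_ge_atTop 1] with i hi hiδ hi1
  set M := N i with hM
  have hMpos : (0 : ℝ) < M := by exact_mod_cast hi1
  have hcont : Continuous fun x : ℝ => q (clampI x) := hq.comp continuous_clampI
  have hint : ∫ s : I, q s
      = ∑ t ∈ Finset.range M, ∫ x in ((t : ℕ) / M : ℝ)..((t + 1 : ℕ) / M : ℝ), q (clampI x) := by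
    rw [integral_unitInterval_eq,
      intervalIntegral.sum_integral_adjacent_intervals (a := fun t : ℕ => (t / M : ℝ))
        (fun k _ => hcont.intervalIntegrable _ _)]
    simp [hMpos.ne']
  -- After the shift, the sample point (t+1)/M is the right end of the cell from t/M to (t+1)/M.
  have hsum : ∑ t ∈ Finset.Icc 1 M, D i t = ∑ t ∈ Finset.range M, D i (t + 1) := by
    rw [Finset.range_eq_Ico, Finset.sum_Ico_add' (fun t => D i t) 0 M 1]
    rfl
  rw [hint, hsum, Finset.mul_sum, Real.dist_eq, ← Finset.sum_sub_distrib]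
  have hterm : ∀ t ∈ Finset.range M, |(M : ℝ)⁻¹ * D i (t + 1)
      - ∫ x in ((t : ℕ) / M : ℝ)..((t + 1 : ℕ) / M : ℝ), q (clampI x)| ≤ (ε / 2) * (M : ℝ)⁻¹ := by
    intro t ht
    have htM : t + 1 ≤ M := Finset.mem_range.1 ht
    have hlen : ((t + 1 : ℕ) / M : ℝ) - ((t : ℕ) / M : ℝ) = (M : ℝ)⁻¹ := by
      push_cast; field_simp; ring
    have hconst : (M : ℝ)⁻¹ * D i (t + 1)
        = ∫ _ in ((t : ℕ) / M : ℝ)..((t + 1 : ℕ) / M : ℝ), D i (t + 1) := by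
      rw [intervalIntegral.integral_const, hlen, smul_eq_mul]
    rw [hconst, ← intervalIntegral.integral_sub (by simp) (hcont.intervalIntegrable _ _),
      ← Real.norm_eq_abs]
    refine (intervalIntegral.norm_integral_le_of_norm_le_const (C := ε / 2) ?_).trans ?_
    · intro x hx
      rw [Set.uIoc_of_le (by rw [← sub_nonneg, hlen]; positivity)] at hx
      have h1 := hi (t + 1) htM
      have h2 : dist (q (clampI ((t + 1 : ℕ) / M : ℝ))) (q (clampI x)) < ε / 4 := by
        refine hqδ ((dist_clampI_le _ _).trans_lt ?_)
        rw [abs_of_nonneg (by linarith [hx.2])]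
        linarith [hx.1]
      rw [Real.dist_eq] at h2
      rw [Real.norm_eq_abs]
      calc _ = |(D i (t + 1) - q (clampI ((t + 1 : ℕ) / M : ℝ)))
            + (q (clampI ((t + 1 : ℕ) / M : ℝ)) - q (clampI x))| := by congr 1; ring
        _ ≤ _ := (abs_add_le _ _).trans (by linarith)
    · rw [hlen, abs_of_nonneg (by positivity)]
  calc _ ≤ ∑ t ∈ Finset.range M, (ε / 2) * (M : ℝ)⁻¹ :=
        (Finset.abs_sum_le_sum_abs _ _).trans (Finset.sum_le_sum hterm)
    _ = ε / 2 := by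
        rw [Finset.sum_const, Finset.card_range, nsmul_eq_mul]; field_simp
    _ < ε := by linarith

/-! ### The self-normalized ratio and its stability under uniform approximation. -/

/-- The self-normalized end point of the discrete path `a 1, …, a N`. -/
def selfNormRatio (a : ℕ → ℝ) (N : ℕ) : ℝ :=
  a N / √((N : ℝ)⁻¹ * ∑ t ∈ Finset.Icc 1 N, (a t - (t / N : ℝ) * a N) ^ 2)

/-- The self-normalized end point of a path on `[0,1]`. -/
def selfNormPath (a : I → ℝ) : ℝ :=
  a 1 / √(∫ s : I, (a s - (s : ℝ) * a 1) ^ 2)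

lemma exists_norm_le_of_continuous {E : Type*} [NormedAddCommGroup E] {a : I → E}
    (ha : Continuous a) : ∃ C, 0 ≤ C ∧ ∀ s, ‖a s‖ ≤ C := by
  obtain ⟨C, hC⟩ := isCompact_univ.exists_bound_of_continuousOn ha.continuousOn
  exact ⟨C, (norm_nonneg _).trans (hC 0 trivial), fun s => hC s trivial⟩

/-- Taking t = N handles the numerator, and the denominator is a perturbed Riemann sum. The filter
is arbitrary so that it can be `atTop` or a product `atTop ×ˢ 𝓝 w`. -/
lemma tendsto_selfNormRatio {ι : Type*} {l : Filter ι} {a : I → ℝ} (ha : Continuous a)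
    (hpos : (∫ s : I, (a s - (s : ℝ) * a 1) ^ 2) ≠ 0)
    {N : ι → ℕ} (hN : Tendsto N l atTop) {f : ι → ℕ → ℝ}
    (hf : ∀ ε > 0, ∀ᶠ i in l, ∀ t ≤ N i, |f i t - a (clampI (t / N i))| ≤ ε) :
    Tendsto (fun i => selfNormRatio (f i) (N i)) l (𝓝 (selfNormPath a)) := by
  have hend : ∀ i, 1 ≤ N i → clampI ((N i : ℝ) / N i) = 1 := fun i hi => by
    rw [div_self (by positivity), clampI_one]
  refine Tendsto.div ?_ (Real.continuous_sqrt.tendsto _ |>.comp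
    (tendsto_riemannSum (q := fun s => (a s - (s : ℝ) * a 1) ^ 2) (by fun_prop) hN ?_))
    (Real.sqrt_ne_zero'.2 (lt_of_le_of_ne (integral_nonneg fun s => sq_nonneg _) hpos.symm))
  · rw [Metric.tendsto_nhds]
    intro ε hε
    filter_upwards [hf (ε / 2) (by positivity), hN.eventually_ge_atTop 1] with i hi hi1
    have := hi (N i) le_rfl
    rw [hend i hi1] at this
    rw [Real.dist_eq]; linarith
  · intro ε hε
    obtain ⟨C, hC0, hC⟩ := exists_norm_le_of_continuous ha
    -- For the discrete bridge x and its limit y, |x - y| ≤ 2δ and |y| ≤ 2C, hence |x² - y²| ≤ 2δ(4C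
    -- + 2) when δ ≤ 1.
    obtain ⟨δ, hδ0, hδ1, hδ⟩ : ∃ δ : ℝ, 0 < δ ∧ δ ≤ 1 ∧ 2 * δ * (4 * C + 2) ≤ ε := by
      refine ⟨min 1 (ε / (2 * (4 * C + 2))), by positivity, min_le_left _ _, ?_⟩
      have := min_le_right (1 : ℝ) (ε / (2 * (4 * C + 2)))
      rw [le_div_iff₀ (by positivity)] at this
      linarith
    filter_upwards [hf δ hδ0, hN.eventually_ge_atTop 1] with i hi hi1 t ht
    have h1 := hi t ht
    have h2 := hi (N i) le_rfl
    rw [hend i hi1] at h2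
    have hs : ((clampI (t / N i : ℝ) : I) : ℝ) = t / N i := clampI_div t (N i) ht
    have hs0 : (0 : ℝ) ≤ t / N i := by positivity
    have hs1 : (t / N i : ℝ) ≤ 1 := hs ▸ (clampI (t / N i : ℝ)).2.2
    have hC1 := hC (clampI (t / N i : ℝ))
    have hC2 := hC 1
    rw [hs]
    set s : ℝ := t / N i
    rw [Real.norm_eq_abs] at hC1 hC2
    have hd : |(f i t - s * f i (N i)) - (a (clampI s) - s * a 1)| ≤ 2 * δ := by
      calc _ = |(f i t - a (clampI s)) - s * (f i (N i) - a 1)| := by congr 1; ring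
        _ ≤ |f i t - a (clampI s)| + |s * (f i (N i) - a 1)| := abs_sub _ _
        _ ≤ δ + 1 * δ := by
          rw [abs_mul, abs_of_nonneg hs0]
          exact add_le_add h1 (mul_le_mul hs1 h2 (abs_nonneg _) zero_le_one)
        _ = _ := by ring
    have hy : |a (clampI s) - s * a 1| ≤ 2 * C := by
      refine (abs_sub _ _).trans ?_
      rw [abs_mul, abs_of_nonneg hs0]
      have : s * |a 1| ≤ 1 * C := mul_le_mul hs1 hC2 (abs_nonneg _) zero_le_one
      linarith
    set x := f i t - s * f i (N i)
    set y := a (clampI s) - s * a 1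
    have hxy : |x + y| ≤ 4 * C + 2 := by
      calc |x + y| = |(x - y) + 2 * y| := by congr 1; ring
        _ ≤ |x - y| + |2 * y| := abs_add_le _ _
        _ ≤ _ := by rw [abs_mul, abs_two]; linarith
    calc |x ^ 2 - y ^ 2| = |x - y| * |x + y| := by rw [← abs_mul]; congr 1; ring
      _ ≤ 2 * δ * (4 * C + 2) := mul_le_mul hd hxy (abs_nonneg _) (by positivity)
      _ ≤ ε := hδ

/-! ### Skorokhod neighbourhoods of continuous paths. -/

/-- Near a continuous path, the Skorokhod topology is at least as fine as the uniform one. -/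
lemma SkorokhodSpace.eventually_dist_le {H : Type*} [PseudoMetricSpace H]
    {w : SkorokhodSpace H} (hw : Continuous w.toFun) {ε : ℝ} (hε : 0 < ε) :
    ∀ᶠ v in 𝓝 w, ∀ t, dist (v t) (w t) ≤ ε := by
  have hu : UniformContinuous w.toFun := CompactSpace.uniformContinuous_of_continuous hw
  obtain ⟨δ, hδ, hwδ⟩ := Metric.uniformContinuous_iff.1 hu (ε / 2) (by positivity)
  filter_upwards [Metric.eball_mem_nhds w
    -- The bound δ lets uniform continuity of `w` absorb the time change; ε / 2 bounds the remaining
    -- spatial error.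
    (show 0 < ENNReal.ofReal (min δ (ε / 2)) by simp [hδ, hε])] with v hv t
  have hv' : (⨅ l : I ≃o I, cost v w l) < ENNReal.ofReal (min δ (ε / 2)) := hv
  obtain ⟨l, hl⟩ := iInf_lt_iff.1 hv'
  have h1 : edist (v t) (w (l t)) < ENNReal.ofReal (min δ (ε / 2)) :=
    ((le_iSup (fun t => edist (v t) (w (l t))) t).trans le_self_add).trans_lt hl
  have h2 : edist t (l t) < ENNReal.ofReal (min δ (ε / 2)) :=
    ((le_iSup (fun t => edist t (l t)) t).trans le_add_self).trans_lt hl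
  rw [edist_dist, ENNReal.ofReal_lt_ofReal_iff (by positivity)] at h1 h2
  have h3 : dist (w (l t)) (w t) < ε / 2 := by
    rw [dist_comm]; exact hwδ (h2.trans_le (min_le_left _ _))
  have h4 := h1.trans_le (min_le_right _ _)
  linarith [dist_triangle (v t) (w (l t)) (w t)]

/-! ### The statistic as a functional of the partial sum path. -/

section Functional

variable {H : Type*} [NormedAddCommGroup H] [InnerProductSpace ℝ H]

/-- The path `⟪w(η), w(η + (1 - η) s) - w(η)⟫` of projected increments after time `η`. -/
def projPath (η : ℝ) (w : I → H) (s : I) : ℝ :=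
  ⟪w (clampI η), w (clampI (η + (1 - η) * s)) - w (clampI η)⟫

/-- The discrete counterpart of `projPath` for samples of size `n`. -/
def projSteps (η : ℝ) (n : ℕ) (w : I → H) (t : ℕ) : ℝ :=
  ⟪w (clampI η), w (clampI ((size₁ η n + t : ℕ) / n : ℝ)) - w (clampI η)⟫

lemma continuous_projPath (η : ℝ) {w : I → H} (hw : Continuous w) :
    Continuous (projPath η w) := by
  have := continuous_clampI
  unfold projPath
  fun_prop

lemma size₁_le {η : ℝ} (h1 : η < 1) (n : ℕ) : size₁ η n ≤ n :=
  Nat.floor_le_of_le (mul_le_of_le_one_right (Nat.cast_nonneg n) h1.le)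

lemma size₁_add_size₂ {η : ℝ} (h1 : η < 1) (n : ℕ) : size₁ η n + size₂ η n = n :=
  Nat.add_sub_cancel' (size₁_le h1 n)

lemma tendsto_size₁ {η : ℝ} (h0 : 0 < η) : Tendsto (size₁ η) atTop atTop :=
  tendsto_nat_floor_atTop.comp (tendsto_natCast_atTop_atTop.atTop_mul_const h0)

lemma tendsto_size₂ {η : ℝ} (h0 : 0 < η) (h1 : η < 1) : Tendsto (size₂ η) atTop atTop := by
  have h : Tendsto (fun n : ℕ => (n : ℝ) * (1 - η)) atTop atTop :=
    tendsto_natCast_atTop_atTop.atTop_mul_const (by linarith)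
  refine tendsto_natCast_atTop_iff.1 (tendsto_atTop_mono (fun n => ?_) h)
  have h2 : (size₁ η n : ℝ) ≤ n * η := Nat.floor_le (by positivity)
  have h3 : (size₁ η n : ℝ) + size₂ η n = n := by exact_mod_cast size₁_add_size₂ h1 n
  linarith

/-- The only discrepancy is the fractional part nη - ⌊nη⌋ < 1: the difference equals -(nη - m₁)(1 -
t/m₂)/n. -/
lemma abs_grid_sub_le {η : ℝ} (h0 : 0 < η) (h1 : η < 1) {n t : ℕ} (hn : 0 < n)
    (ht : t ≤ size₂ η n) :
    |((size₁ η n + t : ℕ) / n : ℝ) - (η + (1 - η) * (t / size₂ η n))| ≤ (n : ℝ)⁻¹ := by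
  have hn' : (0 : ℝ) < n := by exact_mod_cast hn
  have h2 : (size₁ η n : ℝ) ≤ n * η := Nat.floor_le (by positivity)
  have h2' : n * η < (size₁ η n : ℝ) + 1 := Nat.lt_floor_add_one _
  have h3 : (size₁ η n : ℝ) + size₂ η n = n := by exact_mod_cast size₁_add_size₂ h1 n
  have hm : (0 : ℝ) < size₂ η n := by nlinarith
  have ht' : (t : ℝ) ≤ size₂ η n := by exact_mod_cast ht
  set a : ℝ := (size₁ η n : ℝ)
  set m : ℝ := (size₂ η n : ℝ)
  have hkey : ((size₁ η n + t : ℕ) / n : ℝ) - (η + (1 - η) * (t / m))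
      = -((n * η - a) * (1 - t / m)) * (n : ℝ)⁻¹ := by
    push_cast
    have : (n : ℝ) = a + m := h3.symm
    field_simp
    rw [this]
    ring
  have hs0 : 0 ≤ (t : ℝ) / m := by positivity
  have hs1 : (t : ℝ) / m ≤ 1 := (div_le_one hm).2 ht'
  rw [hkey, abs_mul, abs_neg, abs_of_nonneg (inv_nonneg.2 hn'.le),
    abs_of_nonneg (mul_nonneg (by linarith) (by linarith))]
  refine mul_le_of_le_one_left (inv_nonneg.2 hn'.le) ?_
  exact mul_le_one₀ (by linarith) (by linarith) (by linarith)

/-- Here x, q are values of the limit path and y, p those of a nearby path. The bound 2δ for p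
allows one δ for the distance of the paths and one for the grid error in time. -/
lemma abs_inner_sub_inner_le {x y p q : H} {δ C : ℝ} (hδ : δ ≤ 1)
    (hC : 0 ≤ C) (hx : ‖x‖ ≤ C) (hq : ‖q‖ ≤ C) (hyx : ‖y - x‖ ≤ δ) (hpq : ‖p - q‖ ≤ 2 * δ) :
    |⟪y, p - y⟫ - ⟪x, q - x⟫| ≤ δ * (5 * C + 3) := by
  have hδ0 : 0 ≤ δ := (norm_nonneg _).trans hyx
  have hid : ⟪y, p - y⟫ - ⟪x, q - x⟫
      = ⟪y - x, (p - q) - (y - x) + (q - x)⟫ + ⟪x, (p - q) - (y - x)⟫ := by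
    simp only [inner_sub_left, inner_sub_right, inner_add_right]
    ring
  have h1 : ‖(p - q) - (y - x)‖ ≤ 3 * δ := (norm_sub_le _ _).trans (by linarith)
  have h2 : ‖(p - q) - (y - x) + (q - x)‖ ≤ 3 + 2 * C :=
    (norm_add_le _ _).trans (by linarith [norm_sub_le q x])
  rw [hid]
  calc _ ≤ |⟪y - x, (p - q) - (y - x) + (q - x)⟫| + |⟪x, (p - q) - (y - x)⟫| := abs_add_le _ _
    _ ≤ δ * (3 + 2 * C) + C * (3 * δ) := by
      refine add_le_add ((abs_real_inner_le_norm _ _).trans ?_)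
        ((abs_real_inner_le_norm _ _).trans ?_)
      · exact mul_le_mul hyx h2 (norm_nonneg _) hδ0
      · exact mul_le_mul hx h1 (norm_nonneg _) hC
    _ = _ := by ring

/-- Convergence is joint in the sample size and the path, the form required by the extended
continuous mapping theorem. -/
lemma tendsto_selfNormRatio_projSteps {η : ℝ} (h0 : 0 < η) (h1 : η < 1)
    {w : SkorokhodSpace H} (hw : Continuous w.toFun)
    (hpos : (∫ s : I, (projPath η w s - (s : ℝ) * projPath η w 1) ^ 2) ≠ 0) :
    Tendsto (fun p : ℕ × SkorokhodSpace H => selfNormRatio (projSteps η p.1 p.2) (size₂ η p.1))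
      (atTop ×ˢ 𝓝 w) (𝓝 (selfNormPath (projPath η w))) := by
  refine tendsto_selfNormRatio (continuous_projPath η hw) hpos
    ((tendsto_size₂ h0 h1).comp tendsto_fst) fun ε hε => ?_
  obtain ⟨C, hC0, hC⟩ := exists_norm_le_of_continuous hw
  obtain ⟨δ, hδ0, hδ1, hδ⟩ : ∃ δ : ℝ, 0 < δ ∧ δ ≤ 1 ∧ δ * (5 * C + 3) ≤ ε := by
    refine ⟨min 1 (ε / (5 * C + 3)), by positivity, min_le_left _ _, ?_⟩
    have := min_le_right (1 : ℝ) (ε / (5 * C + 3))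
    rwa [le_div_iff₀ (by positivity)] at this
  have hu : UniformContinuous w.toFun := CompactSpace.uniformContinuous_of_continuous hw
  obtain ⟨r, hr, hwr⟩ := Metric.uniformContinuous_iff.1 hu δ hδ0
  have hinv : Tendsto (fun n : ℕ => (n : ℝ)⁻¹) atTop (𝓝 0) :=
    tendsto_inv_atTop_zero.comp tendsto_natCast_atTop_atTop
  filter_upwards [(tendsto_fst (f := atTop) (g := 𝓝 w)).eventually
      ((eventually_gt_atTop 0).and (hinv.eventually (gt_mem_nhds hr))),
    (tendsto_snd (f := (atTop : Filter ℕ)) (g := 𝓝 w)).eventually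
      (SkorokhodSpace.eventually_dist_le hw hδ0)] with p hp1 hp2 t ht
  refine le_trans ?_ hδ
  have hs : ((clampI (t / size₂ η p.1 : ℝ) : I) : ℝ) = t / size₂ η p.1 :=
    clampI_div t _ ht
  have hgrid := abs_grid_sub_le h0 h1 hp1.1 ht
  simp only [projSteps, projPath, Function.comp, hs]
  refine abs_inner_sub_inner_le hδ1 hC0 (hC _) (hC _) ?_ ?_
  · rw [← dist_eq_norm]; exact hp2 _
  · rw [← dist_eq_norm]
    refine (dist_triangle _ (w (clampI ((size₁ η p.1 + t : ℕ) / p.1 : ℝ))) _).trans ?_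
    have := hwr ((dist_clampI_le _ _).trans_lt (hgrid.trans_lt hp1.2))
    linarith [hp2 (clampI ((size₁ η p.1 + t : ℕ) / p.1 : ℝ))]

lemma partialSumPath_clampI_div (X : ℤ → H) {n k : ℕ} (hn : 0 < n) (hk : k ≤ n) :
    partialSumPath X n (clampI (k / n : ℝ)) = (√(n : ℝ))⁻¹ • ∑ i ∈ Finset.Icc 1 k, X (i : ℤ) := by
  have hn' : (n : ℝ) ≠ 0 := by positivity
  simp only [partialSumPath]
  rw [clampI_div k n hk, mul_div_cancel₀ _ hn', Nat.floor_natCast]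

lemma partialSumPath_clampI (X : ℤ → H) {η : ℝ} (h0 : 0 < η) (h1 : η < 1) (n : ℕ) :
    partialSumPath X n (clampI η)
      = (√(n : ℝ))⁻¹ • ∑ i ∈ Finset.Icc 1 (size₁ η n), X (i : ℤ) := by
  simp only [partialSumPath]
  rw [coe_clampI h0.le h1.le, size₁]

/-- Both arguments of the inner product in `projSteps` carry 1/√n, while μ̂₁ carries 1/m₁; this
leaves the factor n/m₁. -/
lemma sum_projZ (X : ℤ → H) {η : ℝ} (h0 : 0 < η) (h1 : η < 1) {n t : ℕ} (hn : 0 < n)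
    (ht : t ≤ size₂ η n) :
    ∑ j ∈ Finset.Icc 1 t, projZ X η n j
      = (n : ℝ) / size₁ η n * projSteps η n (partialSumPath X n) t := by
  have hle : size₁ η n + t ≤ n :=
    (Nat.add_le_add_left ht _).trans_eq (size₁_add_size₂ h1 n)
  have hsplit : ∑ i ∈ Finset.Icc 1 (size₁ η n + t), X (i : ℤ)
      = ∑ i ∈ Finset.Icc 1 (size₁ η n), X (i : ℤ)
        + ∑ j ∈ Finset.Icc 1 t, X ((size₁ η n + j : ℕ) : ℤ) := by
    have hI : ∀ m : ℕ, Finset.Icc 1 m = Finset.Ico 1 (m + 1) := fun m => rfl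
    rw [hI, hI, hI, Finset.sum_Ico_add (fun i : ℕ => X (i : ℤ)) 1 (t + 1) (size₁ η n),
      Finset.sum_Ico_eq_sum_range, Finset.sum_Ico_eq_sum_range, Finset.sum_Ico_eq_sum_range]
    rw [show size₁ η n + t + 1 - 1 = size₁ η n + t by omega, Finset.sum_range_add]
    congr 1
    refine Finset.sum_congr (by congr 1; omega) fun i _ => ?_
    congr 2; ring
  have hn' : (0 : ℝ) < n := by exact_mod_cast hn
  have hsq : (√(n : ℝ))⁻¹ * (√(n : ℝ))⁻¹ = (n : ℝ)⁻¹ := by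
    rw [← mul_inv, Real.mul_self_sqrt hn'.le]
  simp only [projSteps]
  rw [partialSumPath_clampI_div X hn hle, partialSumPath_clampI X h0 h1, hsplit, ← smul_sub,
    add_sub_cancel_left, real_inner_smul_left, real_inner_smul_right, ← mul_assoc, ← mul_assoc,
    mul_assoc (_ / _), hsq]
  simp only [projZ, muHat₁]
  rw [← inner_sum, real_inner_smul_left]
  -- For an empty first block both sides are 0, since division by 0 gives 0.
  rcases eq_or_ne (size₁ η n : ℝ) 0 with h | h
  · simp [h]
  · field_simp

/-- The normalized statistic is a functional of the partial sum path. -/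
lemma sqrt_size₂_mul_statU (X : ℤ → H) {η : ℝ} (h0 : 0 < η) (h1 : η < 1) {n : ℕ}
    (hn₁ : 0 < size₁ η n) (hn₂ : 0 < size₂ η n) :
    √(size₂ η n : ℝ) * statU X η n
      = selfNormRatio (projSteps η n (partialSumPath X n)) (size₂ η n) := by
  have hn : 0 < n := hn₁.trans_le (size₁_le h1 n)
  have hc : 0 < (n : ℝ) / size₁ η n := by positivity
  have hm : (0 : ℝ) < size₂ η n := by exact_mod_cast hn₂
  have hZ := fun t (ht : t ≤ size₂ η n) => sum_projZ X h0 h1 hn ht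
  generalize (n : ℝ) / size₁ η n = c at hc hZ
  generalize projSteps η n (partialSumPath X n) = A at hZ ⊢
  set m := size₂ η n with hmdef
  have hT : statT X η n = (m : ℝ)⁻¹ * (c * A m) := by
    rw [statT, ← hmdef, hZ m le_rfl]
  have hW : selfNormalizer X η n
      = c * (√(m : ℝ))⁻¹ * √((m : ℝ)⁻¹ * ∑ t ∈ Finset.Icc 1 m, (A t - (t / m : ℝ) * A m) ^ 2) := by
    have hsum : ∑ t ∈ Finset.Icc 1 m,
        (∑ j ∈ Finset.Icc 1 t, projZ X η n j - (t : ℝ) * statT X η n) ^ 2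
        = c ^ 2 * ∑ t ∈ Finset.Icc 1 m, (A t - (t / m : ℝ) * A m) ^ 2 := by
      rw [Finset.mul_sum]
      refine Finset.sum_congr rfl fun t ht => ?_
      rw [hZ t (Finset.mem_Icc.1 ht).2, hT, ← mul_pow]
      congr 1
      field_simp
    rw [selfNormalizer, ← hmdef, hsum]
    generalize ∑ t ∈ Finset.Icc 1 m, (A t - (t / m : ℝ) * A m) ^ 2 = Q
    rw [show ((m : ℝ) ^ 2)⁻¹ * (c ^ 2 * Q) = c ^ 2 * ((m : ℝ)⁻¹ * ((m : ℝ)⁻¹ * Q)) by field_simp, Real.sqrt_mul (by positivity), Real.sqrt_sq hc.le,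
      Real.sqrt_mul (by positivity) (_ * _), Real.sqrt_inv, mul_assoc]
  rw [statU, hT, hW, selfNormRatio]
  set R := √((m : ℝ)⁻¹ * ∑ t ∈ Finset.Icc 1 m, (A t - (t / m : ℝ) * A m) ^ 2)
  have hs : √(m : ℝ) * √(m : ℝ) = m := Real.mul_self_sqrt hm.le
  have hs0 : √(m : ℝ) ≠ 0 := (Real.sqrt_pos.2 hm).ne'
  -- A vanishing normalizer makes both quotients 0 by convention.
  rcases eq_or_ne R 0 with hR | hR
  · simp [hR]
  · field_simp
    linear_combination (A m) * hs

end Functional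

/-! ### Continuous mapping for index-dependent functionals. -/

/-- Extended continuous mapping theorem: the maps may depend on the index. -/
theorem TendstoInDistribution.comp_of_tendsto {Ω Ω' E F : Type*} [MeasurableSpace Ω]
    [MeasurableSpace Ω'] {P : Measure Ω} [IsProbabilityMeasure P] {P' : Measure Ω'}
    [IsProbabilityMeasure P'] [PseudoEMetricSpace E] [MeasurableSpace E] [BorelSpace E]
    [TopologicalSpace F] [MeasurableSpace F] [BorelSpace F]
    {X : ℕ → Ω → E} {Z : Ω' → E} (h : TendstoInDistribution X atTop Z (fun _ => P) P')
    {g : ℕ → E → F} {Y : Ω' → F} (hg : ∀ n, AEMeasurable (fun ω => g n (X n ω)) P)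
    (hY : AEMeasurable Y P')
    (hlim : ∀ᵐ ω ∂P', Tendsto (fun p : ℕ × E => g p.1 p.2) (atTop ×ˢ 𝓝 (Z ω)) (𝓝 (Y ω))) :
    TendstoInDistribution (fun n ω => g n (X n ω)) atTop Y (fun _ => P) P' where
  forall_aemeasurable := hg
  aemeasurable_limit := hY
  tendsto := by
    refine tendsto_of_forall_isClosed_limsup_le' fun C hC => ?_
    -- Portmanteau needs a fixed closed set, so the preimages from index k on are collected and
    -- closed up. Closedness also makes `S k` measurable although no `g m` is assumed measurable.
    set S : ℕ → Set E := fun k => closure (⋃ m ≥ k, g m ⁻¹' C)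
    have hS : Antitone S := fun a b hab =>
      closure_mono (Set.biUnion_subset_biUnion_left fun m hm => hab.trans hm)
    have hle : ∀ k, limsup (fun n => (P.map (fun ω => g n (X n ω))) C) atTop
        ≤ P'.map Z (S k) := by
      intro k
      refine le_trans ?_ (ProbabilityMeasure.limsup_measure_closed_le_of_tendsto h.tendsto
        (isClosed_closure (s := ⋃ m ≥ k, g m ⁻¹' C)))
      refine limsup_le_limsup ?_
      filter_upwards [eventually_ge_atTop k] with n hn
      simp only [ProbabilityMeasure.coe_mk]
      rw [Measure.map_apply_of_aemeasurable (hg n) hC.measurableSet,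
        Measure.map_apply_of_aemeasurable (h.forall_aemeasurable n) isClosed_closure.measurableSet]
      exact measure_mono fun ω hω => subset_closure (Set.mem_biUnion hn hω)
    have htend : Tendsto (fun k => P'.map Z (S k)) atTop (𝓝 (P'.map Z (⋂ k, S k))) := by
      have := Measure.isProbabilityMeasure_map (μ := P') h.aemeasurable_limit
      exact tendsto_measure_iInter_atTop
        (fun k => isClosed_closure.measurableSet.nullMeasurableSet) hS ⟨0, measure_ne_top _ _⟩
    refine (ge_of_tendsto' htend hle).trans ?_
    simp only [ProbabilityMeasure.coe_mk]
    rw [Measure.map_apply_of_aemeasurable hY hC.measurableSet,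
      Measure.map_apply_of_aemeasurable h.aemeasurable_limit
        (isClosed_iInter fun k => isClosed_closure).measurableSet]
    refine measure_mono_ae ?_
    filter_upwards [hlim] with ω hω hmem
    -- If Y(ω) ∉ C, joint convergence keeps `g m x` outside C for all large m and all x near Z(ω),
    -- so Z(ω) cannot lie in every `S k`.
    by_contra hn
    obtain ⟨p, hp, q, hq, hpq⟩ := eventually_prod_iff.1
      (hω.eventually (hC.isOpen_compl.mem_nhds hn))
    obtain ⟨k, hk⟩ := eventually_atTop.1 hp
    obtain ⟨x, hxq, hx⟩ := mem_closure_iff_nhds.1 (Set.mem_iInter.1 hmem k) _ hq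
    obtain ⟨m, hm, hxm⟩ := Set.mem_iUnion₂.1 hx
    exact hpq (hk m hm) hxq hxm

/-! ### Scale-invariant events of Gaussian increments -/

/-- The law of `N` independent standard normal variables. -/
abbrev stdGaussianPi (N : ℕ) : Measure (Fin N → ℝ) := Measure.pi fun _ => gaussianReal 0 1

/-- The product of the N(0, v) is the image of the standard one under dilation by √v, which
preserves T. -/
lemma pi_gaussianReal_of_scale_invariant {N : ℕ} {v : NNReal} (hv : v ≠ 0) {T : Set (Fin N → ℝ)}
    (hT : MeasurableSet T) (hscale : ∀ c : ℝ, 0 < c → ∀ x, c • x ∈ T ↔ x ∈ T) :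
    Measure.pi (fun _ : Fin N => gaussianReal 0 v) T = stdGaussianPi N T := by
  have hc : 0 < √(v : ℝ) := Real.sqrt_pos.2 (by positivity)
  have hg : gaussianReal 0 v = (gaussianReal 0 1).map (√(v : ℝ) * ·) := by
    rw [gaussianReal_map_const_mul]
    congr 1
    · simp
    · ext; simp
  have hmeas : Measurable (fun (x : Fin N → ℝ) (i : Fin N) => √(v : ℝ) * x i) := by fun_prop
  have : ∀ i : Fin N, SigmaFinite ((gaussianReal 0 1).map (√(v : ℝ) * ·)) := fun _ => by
    rw [← hg]; infer_instance
  rw [hg, ← Measure.pi_map_pi (μ := fun _ : Fin N => gaussianReal 0 1)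
    (f := fun _ x => √(v : ℝ) * x) (fun i => by fun_prop), Measure.map_apply hmeas hT]
  congr 1
  ext x
  exact hscale _ hc x

/-- Fubini in coordinate 0: with that coordinate frozen at h, the inner products are i.i.d. N(0, v
h), so the inner probability of T does not depend on h. -/
lemma measure_pi_inner_mem {H : Type*} [NormedAddCommGroup H] [InnerProductSpace ℝ H]
    [MeasurableSpace H] [BorelSpace H] [SecondCountableTopology H] {N : ℕ}
    (ν : Fin (N + 1) → Measure H) [∀ i, IsProbabilityMeasure (ν i)] {v : H → NNReal}
    (hv : ∀ᵐ h ∂ν 0, v h ≠ 0)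
    (hlaw : ∀ h (i : Fin N), (ν i.succ).map (fun δ => ⟪δ, h⟫) = gaussianReal 0 (v h))
    {T : Set (Fin N → ℝ)} (hT : MeasurableSet T)
    (hscale : ∀ c : ℝ, 0 < c → ∀ x, c • x ∈ T ↔ x ∈ T) :
    Measure.pi ν {x | (fun i : Fin N => ⟪x i.succ, x 0⟫) ∈ T} = stdGaussianPi N T := by
  have hmp := measurePreserving_piFinSuccAbove ν 0
  have hS : MeasurableSet {p : H × (Fin N → H) | (fun i : Fin N => ⟪p.2 i, p.1⟫) ∈ T} := by
    have hm : Measurable fun (p : H × (Fin N → H)) (i : Fin N) => ⟪p.2 i, p.1⟫ :=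
      measurable_pi_lambda _ fun i =>
        ((measurable_pi_apply i).comp measurable_snd).inner measurable_fst
    exact hm hT
  have hpre := hmp.measure_preimage hS.nullMeasurableSet
  have hset : (MeasurableEquiv.piFinSuccAbove (fun _ : Fin (N + 1) => H) 0) ⁻¹'
      {p : H × (Fin N → H) | (fun i : Fin N => ⟪p.2 i, p.1⟫) ∈ T}
      = {x | (fun i : Fin N => ⟪x i.succ, x 0⟫) ∈ T} := by
    rfl
  rw [← hset, hpre, Measure.prod_apply hS]
  have hinner : ∀ᵐ h ∂ν 0, (Measure.pi fun j : Fin N => ν (Fin.succAbove 0 j))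
      (Prod.mk h ⁻¹' {p : H × (Fin N → H) | (fun i : Fin N => ⟪p.2 i, p.1⟫) ∈ T})
      = stdGaussianPi N T := by
    filter_upwards [hv] with h hh
    have hmeas : Measurable (fun (x : Fin N → H) (i : Fin N) => ⟪x i, h⟫) :=
      measurable_pi_lambda _ fun i => (measurable_pi_apply i).inner_const
    have hl : ∀ i : Fin N, (ν (Fin.succAbove 0 i)).map (fun δ => ⟪δ, h⟫)
        = gaussianReal 0 (v h) := fun i => by
      rw [Fin.succAbove_zero]; exact hlaw h i
    have : ∀ i : Fin N, SigmaFinite ((ν (Fin.succAbove 0 i)).map (fun δ => ⟪δ, h⟫)) :=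
      fun i => by rw [hl]; infer_instance
    rw [← pi_gaussianReal_of_scale_invariant hh hT hscale]
    rw [show (fun _ : Fin N => gaussianReal 0 (v h))
        = fun i => (ν (Fin.succAbove 0 i)).map (fun δ => ⟪δ, h⟫) from funext fun i => (hl i).symm,
      ← Measure.pi_map_pi (μ := fun i : Fin N => ν (Fin.succAbove 0 i))
      (f := fun _ δ => ⟪δ, h⟫) (fun i => (measurable_id.inner_const).aemeasurable),
      Measure.map_apply hmeas hT]
    rfl
  rw [lintegral_congr_ae hinner]
  simp

/-! ### Increments of Brownian motion -/

namespace IsBrownianMotion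

variable {Ω H : Type*} [MeasurableSpace Ω] [NormedAddCommGroup H] [InnerProductSpace ℝ H]
  [MeasurableSpace H] {W : I → Ω → H} {S : H →L[ℝ] H} {P : Measure Ω}

lemma map_inner_sub [BorelSpace H] (hW : IsBrownianMotion W S P) {s t : I} (hst : s ≤ t) (h : H) :
    P.map (fun ω => ⟪W t ω - W s ω, h⟫)
      = gaussianReal 0 (((t : ℝ) - s) * ⟪S h, h⟫).toNNReal := by
  have hG : HasGaussianLaw (fun ω => ⟪W t ω - W s ω, h⟫) P := by
    have := (hW.gaussian s t hst).map_fun (innerSL ℝ h)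
    simpa [real_inner_comm] using this
  rw [hG.map_eq_gaussianReal, hW.mean s t hst h,
    variance_of_integral_eq_zero hG.aemeasurable (hW.mean s t hst h),
    ← hW.covariance s t hst h h]
  simp_rw [pow_two]

lemma covariance_zero_one (hW : IsBrownianMotion W S P) (x y : H) :
    ∫ ω, ⟪W 1 ω - W 0 ω, x⟫ * ⟪W 1 ω - W 0 ω, y⟫ ∂P = ⟪S x, y⟫ := by
  simpa using hW.covariance 0 1 zero_le_one x y

lemma inner_comm (hW : IsBrownianMotion W S P) (x y : H) : ⟪S x, y⟫ = ⟪S y, x⟫ := by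
  rw [← hW.covariance_zero_one, ← hW.covariance_zero_one]
  simp_rw [mul_comm]

lemma inner_self_nonneg (hW : IsBrownianMotion W S P) (x : H) : 0 ≤ ⟪S x, x⟫ := by
  rw [← hW.covariance_zero_one]
  exact integral_nonneg fun ω => mul_self_nonneg _

/-- This is Cauchy–Schwarz for the positive semidefinite form ⟪S x, y⟫, whose isotropic vectors form
the kernel of S. -/
lemma apply_eq_zero (hW : IsBrownianMotion W S P) {x : H} (hx : ⟪S x, x⟫ = 0) : S x = 0 := by
  refine ext_inner_right ℝ fun y => ?_
  rw [inner_zero_left]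
  set b := ⟪S x, y⟫ with hb
  set c := ⟪S y, y⟫
  have hc : 0 ≤ c := hW.inner_self_nonneg y
  have key : ∀ t : ℝ, 0 ≤ 2 * t * b + t ^ 2 * c := fun t => by
    have := hW.inner_self_nonneg (x + t • y)
    simp only [map_add, map_smul, inner_add_left, inner_add_right, real_inner_smul_left,
      real_inner_smul_right, hx, hW.inner_comm y x, ← hb] at this
    linarith
  -- The 1 in c + 1 avoids a separate case c = 0; the quadratic then equals -b²(c + 2)/(c + 1)².
  have h := key (-b / (c + 1))
  have h' : 2 * (-b / (c + 1)) * b + (-b / (c + 1)) ^ 2 * c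
      = -(b ^ 2 * (c + 2)) / (c + 1) ^ 2 := by
    field_simp; ring
  rw [h', le_div_iff₀ (by positivity), zero_mul] at h
  have : b ^ 2 = 0 := by nlinarith [sq_nonneg b]
  exact pow_eq_zero_iff two_ne_zero |>.1 this

/-- A nondegenerate Brownian motion avoids the isotropic vectors of its covariance. -/
lemma ae_inner_pos [BorelSpace H] [SecondCountableTopology H] (hW : IsBrownianMotion W S P) (hS : S ≠ 0) {s t : I} (hst : s < t) :
    ∀ᵐ ω ∂P, 0 < ⟪S (W t ω - W s ω), W t ω - W s ω⟫ := by
  obtain ⟨x, hx⟩ : ∃ x, S x ≠ 0 := by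
    by_contra! h
    exact hS (ContinuousLinearMap.ext h)
  -- The test direction is S x: if it were isotropic, then S(S x) = 0 and ‖S x‖² = ⟪S(S x), x⟫ = 0.
  have hy : 0 < ⟪S (S x), S x⟫ := by
    refine lt_of_le_of_ne (hW.inner_self_nonneg _) fun h => hx ?_
    have h0 := hW.apply_eq_zero h.symm
    have h1 := hW.inner_comm (S x) x
    rw [h0, inner_zero_left] at h1
    exact inner_self_eq_zero.1 h1.symm
  have hst' : (0 : ℝ) < (t : ℝ) - s := sub_pos.2 hst
  have hne : (((t : ℝ) - s) * ⟪S (S x), S x⟫).toNNReal ≠ 0 := by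
    simpa using mul_pos hst' hy
  have hG := nullSingletonClass_gaussianReal (μ := 0) hne
  have hG0 : P.map (fun ω => ⟪W t ω - W s ω, S x⟫) {0} = 0 := by
    rw [hW.map_inner_sub hst.le]; exact measure_singleton _
  have hmeas : AEMeasurable (fun ω => ⟪W t ω - W s ω, S x⟫) P :=
    ((hW.gaussian s t hst.le).aemeasurable).inner_const
  rw [Measure.map_apply_of_aemeasurable hmeas (measurableSet_singleton 0)] at hG0
  have hae : ∀ᵐ ω ∂P, ⟪W t ω - W s ω, S x⟫ ≠ 0 := by
    rw [ae_iff]; simpa [Set.preimage] using hG0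
  filter_upwards [hae] with ω hω
  -- An isotropic increment Δ satisfies SΔ = 0, hence ⟪Δ, S x⟫ = ⟪SΔ, x⟫ = 0, which is excluded
  -- almost surely.
  refine lt_of_le_of_ne (hW.inner_self_nonneg _) fun h => hω ?_
  have h0 := hW.apply_eq_zero h.symm
  rw [real_inner_comm, hW.inner_comm x, h0, inner_zero_left]

lemma map_increments [BorelSpace H] [SecondCountableTopology H] (hW : IsBrownianMotion W S P) {n : ℕ}
    {τ : Fin (n + 1) → I} (hτ : Monotone τ) :
    P.map (fun ω (i : Fin n) => W (τ i.succ) ω - W (τ i.castSucc) ω)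
      = Measure.pi fun i : Fin n => P.map (fun ω => W (τ i.succ) ω - W (τ i.castSucc) ω) :=
  iIndepFun.map_fun_eq_pi_map
    (fun _ => ((hW.measurable _).sub (hW.measurable _)).aemeasurable) (hW.indep_increments n τ hτ)

end IsBrownianMotion

/-! ### Processes with Brownian increments up to a random scale -/

/-- A continuous process on `[0,1]` started at `0` whose increments over regular grids assign the
Gaussian probability to every scale-invariant event. -/
structure HasScaledBrownianIncrements {Ω : Type*} [MeasurableSpace Ω] (A : I → Ω → ℝ)
    (P : Measure Ω) : Prop where
  measurable : ∀ t, Measurable (A t)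
  zero : ∀ᵐ ω ∂P, A 0 ω = 0
  continuous : ∀ᵐ ω ∂P, Continuous fun t => A t ω
  law : ∀ N : ℕ, 0 < N → ∀ T : Set (Fin N → ℝ), MeasurableSet T →
    (∀ c : ℝ, 0 < c → ∀ x, c • x ∈ T ↔ x ∈ T) →
    P {ω | (fun i : Fin N => A (clampI ((i + 1 : ℕ) / N : ℝ)) ω - A (clampI (i / N : ℝ)) ω) ∈ T}
      = stdGaussianPi N T

lemma IsStandardBrownianMotion.hasScaledBrownianIncrements {Ω : Type*} [MeasurableSpace Ω]
    {B : I → Ω → ℝ} {P : Measure Ω} (hB : IsStandardBrownianMotion B P) :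
    HasScaledBrownianIncrements B P where
  measurable := IsBrownianMotion.measurable hB
  zero := IsBrownianMotion.zero hB
  continuous := IsBrownianMotion.continuous hB
  law N hN T hT hscale := by
    have hB' : IsBrownianMotion B (ContinuousLinearMap.id ℝ ℝ) P := hB
    set τ : Fin (N + 1) → I := fun k => clampI ((k : ℕ) / N : ℝ) with hτ
    have hmono : Monotone τ := fun a b hab => monotone_clampI (by gcongr; exact hab)
    have hlaw : ∀ i : Fin N, P.map (fun ω => B (τ i.succ) ω - B (τ i.castSucc) ω)
        = gaussianReal 0 (N : NNReal)⁻¹ := fun i => by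
      have h := hB'.map_inner_sub (hmono i.castSucc_le_succ) 1
      have e1 : ((τ i.succ : I) : ℝ) = ((i : ℕ) + 1 : ℕ) / N := by
        rw [hτ]; exact clampI_div _ _ i.2
      have e2 : ((τ i.castSucc : I) : ℝ) = (i : ℕ) / N := by
        rw [hτ]; exact clampI_div _ _ i.2.le
      have e3 : ((((i : ℕ) + 1 : ℕ) / N - (i : ℕ) / N : ℝ)) = (N : ℝ)⁻¹ := by
        push_cast; field_simp; ring
      rw [e1, e2, e3] at h
      simpa [Real.toNNReal_inv] using h
    have hmeasX : Measurable fun ω (i : Fin N) => B (τ i.succ) ω - B (τ i.castSucc) ω :=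
      measurable_pi_lambda _ fun i => (hB'.measurable _).sub (hB'.measurable _)
    have hmap := hB'.map_increments hmono
    simp_rw [hlaw] at hmap
    rw [← pi_gaussianReal_of_scale_invariant (by positivity : (N : NNReal)⁻¹ ≠ 0) hT hscale,
      ← hmap, Measure.map_apply hmeasX hT]
    rfl

/-- W(η) plays the frozen coordinate of `measure_pi_inner_mem`; it is the increment over [0, η],
independent of those after η. -/
lemma IsBrownianMotion.hasScaledBrownianIncrements_projPath {Ω H : Type*} [MeasurableSpace Ω]
    [NormedAddCommGroup H] [InnerProductSpace ℝ H] [MeasurableSpace H] [BorelSpace H]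
    [SecondCountableTopology H] {W : I → Ω → H} {S : H →L[ℝ] H} {P : Measure Ω}
    [IsProbabilityMeasure P]
    (hW : IsBrownianMotion W S P) (hS : S ≠ 0) {η : ℝ} (h0 : 0 < η) (h1 : η < 1) :
    HasScaledBrownianIncrements (fun t ω => projPath η (fun s => W s ω) t) P where
  measurable t := (hW.measurable _).inner ((hW.measurable _).sub (hW.measurable _))
  zero := .of_forall fun ω => by simp [projPath]
  continuous := hW.continuous.mono fun ω hω => continuous_projPath η hω
  law N hN T hT hscale := by
    have hN' : (0 : ℝ) < N := by exact_mod_cast hN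
    have hη : ((clampI η : I) : ℝ) = η := coe_clampI h0.le h1.le
    set ρ : ℕ → I := fun k => clampI (η + (1 - η) * (clampI (k / N : ℝ) : I)) with hρ
    have hρmono : Monotone ρ := fun a b hab => monotone_clampI <| by
      have h2 : (clampI (a / N : ℝ) : ℝ) ≤ clampI (b / N : ℝ) :=
        monotone_clampI (by gcongr)
      have := mul_le_mul_of_nonneg_left h2 (sub_nonneg.2 h1.le)
      linarith
    have hρ0 : ρ 0 = clampI η := by simp [hρ, clampI_zero]
    have hρval : ∀ k ≤ N, ((ρ k : I) : ℝ) = η + (1 - η) * (k / N) := fun k hk => by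
      have hk0 : (0 : ℝ) ≤ k / N := by positivity
      have hk1 : (k / N : ℝ) ≤ 1 := div_le_one_of_le₀ (by exact_mod_cast hk) hN'.le
      rw [hρ]
      dsimp only
      rw [clampI_div k N hk, coe_clampI (by nlinarith) (by nlinarith)]
    -- The time 0 is put before the N + 1 grid points of [η, 1], so that increment number 0 is W(η)
    -- - W(0).
    set τ : Fin (N + 2) → I := Fin.cons 0 (fun k : Fin (N + 1) => ρ k) with hτ
    have hmono : Monotone τ := by
      refine Fin.monotone_iff_le_succ.2 fun i => ?_
      refine Fin.cases ?_ (fun j => ?_) i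
      · exact (clampI η).2.1.trans_eq (by simp [hτ, hρ0])
      · rw [← Fin.succ_castSucc]
        simp only [hτ, Fin.cons_succ]
        exact hρmono (by simp)
    have hX : ∀ i : Fin (N + 1), Measurable fun ω => W (τ i.succ) ω - W (τ i.castSucc) ω :=
      fun i => (hW.measurable _).sub (hW.measurable _)
    have hmap := hW.map_increments hmono
    set ν : Fin (N + 1) → Measure H :=
      fun i => P.map (fun ω => W (τ i.succ) ω - W (τ i.castSucc) ω) with hν
    have : ∀ i, IsProbabilityMeasure (ν i) := fun i =>
      Measure.isProbabilityMeasure_map (hX i).aemeasurable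
    have hv : ∀ᵐ h ∂ν 0, ((1 - η) / N * ⟪S h, h⟫).toNNReal ≠ 0 := by
      have hm : Measurable fun h : H => ((1 - η) / N * ⟪S h, h⟫).toNNReal :=
        (((S.continuous.measurable).inner measurable_id).const_mul _).real_toNNReal
      refine (ae_map_iff (hX 0).aemeasurable (hm (measurableSet_singleton 0)).compl).2 ?_
      have hlt : τ (Fin.castSucc 0) < τ (Fin.succ 0) := by
        rw [← Subtype.coe_lt_coe]
        simpa [hτ, hρ0, hη] using h0
      filter_upwards [hW.ae_inner_pos hS hlt] with ω hω
      have := mul_pos (div_pos (sub_pos.2 h1) hN') hω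
      simpa using this
    have hlaw : ∀ h (i : Fin N), (ν i.succ).map (fun δ => ⟪δ, h⟫)
        = gaussianReal 0 ((1 - η) / N * ⟪S h, h⟫).toNNReal := fun h i => by
      have hi : Measurable fun δ : H => ⟪δ, h⟫ := measurable_id.inner_const
      rw [hν]
      dsimp only
      rw [Measure.map_map hi (hX i.succ)]
      have h2 := hW.map_inner_sub (hmono i.succ.castSucc_le_succ) h
      have e1 : ((τ i.succ.succ : I) : ℝ) = η + (1 - η) * (((i : ℕ) + 1 : ℕ) / N) := by
        simp only [hτ, Fin.cons_succ]
        exact hρval _ i.2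
      have e2 : ((τ i.succ.castSucc : I) : ℝ) = η + (1 - η) * ((i : ℕ) / N) := by
        rw [← Fin.succ_castSucc]
        simp only [hτ, Fin.cons_succ]
        exact hρval _ i.2.le
      have e3 : (η + (1 - η) * (((i : ℕ) + 1 : ℕ) / N)) - (η + (1 - η) * ((i : ℕ) / N))
          = (1 - η) / N := by
        push_cast; field_simp; ring
      rw [e1, e2, e3] at h2
      exact h2
    have hmain := measure_pi_inner_mem ν hv hlaw hT hscale
    have hset : MeasurableSet {x : Fin (N + 1) → H | (fun i : Fin N => ⟪x i.succ, x 0⟫) ∈ T} := by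
      have hm : Measurable fun (x : Fin (N + 1) → H) (i : Fin N) => ⟪x i.succ, x 0⟫ :=
        measurable_pi_lambda _ fun i => (measurable_pi_apply _).inner (measurable_pi_apply _)
      exact hm hT
    rw [← hmain, ← hmap, Measure.map_apply (measurable_pi_lambda _ hX) hset]
    refine measure_congr ?_
    filter_upwards [hW.zero] with ω hω
    refine congrArg (fun x : Fin N → ℝ => x ∈ T) (funext fun i => ?_)
    have e0 : W (τ (Fin.succ 0)) ω - W (τ (Fin.castSucc 0)) ω = W (clampI η) ω := by
      simp [hτ, hρ0, hω]
    have e1 : τ i.succ.succ = ρ (i + 1) := rfl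
    have e2 : τ i.succ.castSucc = ρ i := rfl
    dsimp only
    rw [e0, e1, e2]
    simp only [projPath, hρ]
    rw [← inner_sub_right, sub_sub_sub_cancel_right, real_inner_comm]

/-! ### The law of the self-normalized end point -/

lemma selfNormRatio_congr {a b : ℕ → ℝ} {N : ℕ} (h : ∀ t ≤ N, a t = b t) :
    selfNormRatio a N = selfNormRatio b N := by
  rw [selfNormRatio, selfNormRatio, h N le_rfl]
  congr 3
  exact Finset.sum_congr rfl fun t ht => by rw [h t (Finset.mem_Icc.1 ht).2]

lemma selfNormRatio_const_mul {c : ℝ} (hc : 0 < c) (a : ℕ → ℝ) (N : ℕ) :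
    selfNormRatio (fun t => c * a t) N = selfNormRatio a N := by
  have h : (N : ℝ)⁻¹ * ∑ t ∈ Finset.Icc 1 N, (c * a t - (t / N : ℝ) * (c * a N)) ^ 2
      = c ^ 2 * ((N : ℝ)⁻¹ * ∑ t ∈ Finset.Icc 1 N, (a t - (t / N : ℝ) * a N) ^ 2) := by
    rw [mul_left_comm (c ^ 2)]
    congr 1
    rw [Finset.mul_sum]
    exact Finset.sum_congr rfl fun t _ => by ring
  rw [selfNormRatio, h, Real.sqrt_mul (by positivity), Real.sqrt_sq hc.le,
    mul_div_mul_left _ _ hc.ne', selfNormRatio]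

/-- The self-normalized end point of the path with increments `x`. -/
def incrRatio (N : ℕ) (x : Fin N → ℝ) : ℝ :=
  selfNormRatio (fun t => ∑ j : Fin N, if (j : ℕ) < t then x j else 0) N

lemma measurable_incrRatio (N : ℕ) : Measurable (incrRatio N) := by
  have h : ∀ t : ℕ, Measurable fun x : Fin N → ℝ =>
      ∑ j : Fin N, if (j : ℕ) < t then x j else 0 := fun t =>
    Finset.measurable_sum _ fun j _ => by split_ifs <;> fun_prop
  unfold incrRatio selfNormRatio
  exact (h N).div (((Finset.measurable_sum _ fun t _ =>
    ((h t).sub ((h N).const_mul _)).pow_const 2).const_mul _).sqrt)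

lemma incrRatio_smul {N : ℕ} {c : ℝ} (hc : 0 < c) (x : Fin N → ℝ) :
    incrRatio N (c • x) = incrRatio N x := by
  unfold incrRatio
  refine Eq.trans ?_ (selfNormRatio_const_mul hc _ N)
  congr 1
  funext t
  rw [Finset.mul_sum]
  exact Finset.sum_congr rfl fun j _ => by split_ifs <;> simp

lemma incrRatio_sub (a : ℕ → ℝ) (h0 : a 0 = 0) (N : ℕ) :
    incrRatio N (fun j => a (j + 1) - a j) = selfNormRatio a N := by
  refine selfNormRatio_congr fun t ht => ?_
  rw [Fin.sum_univ_eq_sum_range (fun j => if j < t then a (j + 1) - a j else 0) N,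
    ← Finset.sum_filter]
  rw [show (Finset.range N).filter (· < t) = Finset.range t by ext j; simp; omega,
    Finset.sum_range_sub, h0, sub_zero]

namespace HasScaledBrownianIncrements

variable {Ω : Type*} [MeasurableSpace Ω] {A : I → Ω → ℝ} {P : Measure Ω}

/-- The bridge vanishes at 1/2 exactly when the two half increments agree. This event is
scale-invariant, and the diagonal of the plane is Gaussian-null. -/
lemma ae_half_ne (hA : HasScaledBrownianIncrements A P) :
    ∀ᵐ ω ∂P, A (clampI (1 / 2)) ω - (1 / 2) * A 1 ω ≠ 0 := by
  have hT : MeasurableSet {x : Fin 2 → ℝ | x 1 = x 0} :=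
    measurableSet_eq_fun (measurable_pi_apply 1) (measurable_pi_apply 0)
  have h := hA.law 2 two_pos {x | x 1 = x 0} hT
    (fun c hc x => by simp [hc.ne'])
  have hnull : stdGaussianPi 2 {x | x 1 = x 0} = 0 := by
    have hmp := measurePreserving_piFinTwo (fun _ : Fin 2 => gaussianReal 0 1)
    have hS : MeasurableSet {p : ℝ × ℝ | p.2 = p.1} :=
      measurableSet_eq_fun measurable_snd measurable_fst
    have hpre := hmp.measure_preimage hS.nullMeasurableSet
    have := nullSingletonClass_gaussianReal (μ := 0) (v := 1) one_ne_zero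
    rw [(Measure.measure_prod_null hS).2 (.of_forall fun x => by
      have : Prod.mk x ⁻¹' {p : ℝ × ℝ | p.2 = p.1} = {x} := by ext; simp
      simp [this])] at hpre
    exact hpre
  rw [hnull] at h
  have hae : ∀ᵐ ω ∂P, ¬ (A (clampI ((1 + 1 : ℕ) / 2 : ℝ)) ω - A (clampI ((1 : ℕ) / 2 : ℝ)) ω
      = A (clampI ((0 + 1 : ℕ) / 2 : ℝ)) ω - A (clampI ((0 : ℕ) / 2 : ℝ)) ω) := by
    rw [ae_iff]
    simpa using h
  filter_upwards [hae, hA.zero] with ω hω h0 h1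
  apply hω
  norm_num [clampI_zero, clampI_one, h0]
  norm_num at h1
  linarith

lemma ae_integral_ne_zero (hA : HasScaledBrownianIncrements A P) :
    ∀ᵐ ω ∂P, (∫ s : I, (A s ω - (s : ℝ) * A 1 ω) ^ 2) ≠ 0 := by
  filter_upwards [hA.ae_half_ne, hA.continuous] with ω hω hc
  rw [integral_unitInterval_eq]
  refine (intervalIntegral.integral_pos zero_lt_one ?_ (fun x _ => sq_nonneg _)
    ⟨1 / 2, by norm_num, ?_⟩).ne'
  · have := continuous_clampI
    have h2 : Continuous fun x : ℝ => A (clampI x) ω := hc.comp this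
    fun_prop
  · rw [coe_clampI (by norm_num) (by norm_num)]
    positivity

lemma ae_tendsto (hA : HasScaledBrownianIncrements A P) :
    ∀ᵐ ω ∂P, Tendsto (fun N : ℕ => incrRatio N fun i =>
      A (clampI ((i + 1 : ℕ) / N : ℝ)) ω - A (clampI (i / N : ℝ)) ω) atTop
      (𝓝 (selfNormPath fun s => A s ω)) := by
  filter_upwards [hA.ae_integral_ne_zero, hA.continuous, hA.zero] with ω hω hc h0
  refine (tendsto_selfNormRatio hc hω tendsto_id
    (f := fun N t => A (clampI (t / N : ℝ)) ω) fun ε hε => .of_forall fun N t _ => ?_).congr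
    fun N => ?_
  · simpa using hε.le
  · exact (incrRatio_sub (fun t => A (clampI (t / N : ℝ)) ω) (by simp [clampI_zero, h0]) N).symm

lemma measurable_increments (hA : HasScaledBrownianIncrements A P) (N : ℕ) :
    Measurable fun ω (i : Fin N) =>
      A (clampI ((i + 1 : ℕ) / N : ℝ)) ω - A (clampI (i / N : ℝ)) ω :=
  measurable_pi_lambda _ fun _ => (hA.measurable _).sub (hA.measurable _)

lemma aemeasurable_selfNormPath (hA : HasScaledBrownianIncrements A P) :
    AEMeasurable (fun ω => selfNormPath fun s => A s ω) P :=
  aemeasurable_of_tendsto_metrizable_ae atTop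
    (fun N => ((measurable_incrRatio N).comp (hA.measurable_increments N)).aemeasurable)
    hA.ae_tendsto

/-- The approximating laws on the left do not involve A, which is what allows two different
processes to be compared. -/
lemma tendstoInDistribution_incrRatio [IsProbabilityMeasure P]
    (hA : HasScaledBrownianIncrements A P) :
    TendstoInDistribution incrRatio atTop (fun ω => selfNormPath fun s => A s ω)
      (fun N => stdGaussianPi N) P where
  forall_aemeasurable N := (measurable_incrRatio N).aemeasurable
  aemeasurable_limit := hA.aemeasurable_selfNormPath
  tendsto := by
    have h := (tendstoInDistribution_of_ae_tendsto
      (fun N => ((measurable_incrRatio N).comp (hA.measurable_increments N)).aemeasurable)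
      hA.aemeasurable_selfNormPath hA.ae_tendsto).tendsto
    refine h.congr' ?_
    filter_upwards [eventually_gt_atTop 0] with N hN
    refine Subtype.ext (Measure.ext fun T hT => ?_)
    dsimp only
    rw [Measure.map_apply ((measurable_incrRatio N).comp (hA.measurable_increments N)) hT,
      Measure.map_apply (measurable_incrRatio N) hT,
      -- Preimages under `incrRatio N` are scale-invariant, so the increments of A may be replaced
      -- by standard Gaussians.
      ← hA.law N hN _ (measurable_incrRatio N hT) fun c hc x => by
        rw [Set.mem_preimage, Set.mem_preimage, incrRatio_smul hc]]
    rfl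

/-- The law of the self-normalized end point does not depend on the process. -/
lemma map_selfNormPath_eq [IsProbabilityMeasure P] (hA : HasScaledBrownianIncrements A P)
    {Ω' : Type*} [MeasurableSpace Ω'] {A' : I → Ω' → ℝ} {P' : Measure Ω'}
    [IsProbabilityMeasure P'] (hA' : HasScaledBrownianIncrements A' P') :
    P.map (fun ω => selfNormPath fun s => A s ω)
      = P'.map (fun ω => selfNormPath fun s => A' s ω) :=
  tendstoInDistribution_unique _ hA.tendstoInDistribution_incrRatio
    hA'.tendstoInDistribution_incrRatio

end HasScaledBrownianIncrements

/-! ### Reproducing kernel Hilbert spaces of continuous kernels -/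

section RKHS

variable {E : Type*} {H : Type*} [NormedAddCommGroup H]
  [InnerProductSpace ℝ H] [CompleteSpace H] [RKHS ℝ H E ℝ] {K : E → E → ℝ}

lemma inner_kernelSection (hHK : IsRKHSOf H K) (x y : E) :
    ⟪kernelSection H x, kernelSection H y⟫ = K x y := by
  rw [real_inner_comm, ← hHK x y, ← RKHS.kerFun_apply]
  simp [kernelSection]

/-- The reproducing property gives ‖K(y,·) - K(x,·)‖² = K(y,y) - 2K(y,x) + K(x,x). -/
lemma continuous_kernelSection [TopologicalSpace E] (hK : IsContinuousPDKernel K) (hHK : IsRKHSOf H K) :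
    Continuous (kernelSection H : E → H) := by
  refine continuous_iff_continuousAt.2 fun x => tendsto_iff_norm_sub_tendsto_zero.2 ?_
  have hsq : ∀ y, ‖kernelSection H y - kernelSection H x‖
      = √(K y y - 2 * K y x + K x x) := fun y => by
    rw [← Real.sqrt_sq (norm_nonneg (kernelSection H y - kernelSection H x)),
      norm_sub_sq_real, ← real_inner_self_eq_norm_sq, ← real_inner_self_eq_norm_sq,
      inner_kernelSection hHK, inner_kernelSection hHK, inner_kernelSection hHK]
  simp_rw [hsq]
  have h1 : Continuous fun y => K y y := hK.continuous.comp (continuous_id.prodMk continuous_id)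
  have h2 : Continuous fun y => K y x := hK.continuous.comp (continuous_id.prodMk continuous_const)
  have h3 : Continuous fun y => √(K y y - 2 * K y x + K x x) :=
    ((h1.sub (continuous_const.mul h2)).add continuous_const).sqrt
  have := h3.tendsto x
  rwa [show K x x - 2 * K x x + K x x = 0 by ring, Real.sqrt_zero] at this

/-- The kernel sections are a continuous image of a separable space and span a dense subspace.
Second countability makes sums and inner products of H-valued random variables measurable. -/
lemma secondCountableTopology_of_kernel [TopologicalSpace E] [TopologicalSpace.SeparableSpace E]
    (hK : IsContinuousPDKernel K) (hHK : IsRKHSOf H K) : SecondCountableTopology H := by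
  have hset : {RKHS.kerFun H x v | (x : E) (v : ℝ)}
      ⊆ (Submodule.span ℝ (Set.range (kernelSection H : E → H)) : Set H) := by
    rintro _ ⟨x, v, rfl⟩
    have : RKHS.kerFun H x v = v • kernelSection H x := by
      rw [kernelSection, ← map_smul, smul_eq_mul, mul_one]
    rw [this]
    exact Submodule.smul_mem _ _ (Submodule.subset_span ⟨x, rfl⟩)
  have hsep : TopologicalSpace.IsSeparable
      (closure (Submodule.span ℝ (Set.range (kernelSection H : E → H)) : Set H)) :=
    (TopologicalSpace.isSeparable_range (continuous_kernelSection hK hHK)).span.closure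
  have huniv : TopologicalSpace.IsSeparable (Set.univ : Set H) := by
    refine hsep.mono fun x _ => ?_
    have hx : x ∈ (Submodule.span ℝ {RKHS.kerFun H x v | (x : E) (v : ℝ)}).topologicalClosure := by
      rw [RKHS.kerFun_dense H]; trivial
    exact closure_mono (Submodule.span_le.2 hset) hx
  have : TopologicalSpace.SeparableSpace H :=
    TopologicalSpace.isSeparable_univ_iff.1 huniv
  exact UniformSpace.secondCountable_of_separable H

end RKHS

/-! ### Measurability of the statistic and the limit theorem. -/

lemma measurable_statU {Ω H : Type*} [MeasurableSpace Ω] [NormedAddCommGroup H]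
    [InnerProductSpace ℝ H] [MeasurableSpace H] [BorelSpace H] [SecondCountableTopology H]
    {X : Ω → ℤ → H} (hX : ∀ i, Measurable fun ω => X ω i) (η : ℝ) (n : ℕ) :
    Measurable fun ω => statU (X ω) η n := by
  have hmu : Measurable fun ω => muHat₁ (X ω) η n :=
    (Finset.measurable_sum _ fun i _ => hX _).const_smul _
  have hZ : ∀ i, Measurable fun ω => projZ (X ω) η n i := fun i => hmu.inner (hX _)
  have hT : Measurable fun ω => statT (X ω) η n :=
    (Finset.measurable_sum _ fun i _ => hZ i).const_mul _
  exact hT.div (((Finset.measurable_sum _ fun t _ =>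
    ((Finset.measurable_sum _ fun j _ => hZ j).sub (hT.const_mul _)).pow_const 2).const_mul _).sqrt)

theorem theorem3p1 {p : ℕ}
    -- the kernel and its reproducing kernel Hilbert space
    (K : EuclideanSpace ℝ (Fin p) → EuclideanSpace ℝ (Fin p) → ℝ) (hK : IsContinuousPDKernel K)
    {H : Type*} [NormedAddCommGroup H] [InnerProductSpace ℝ H] [CompleteSpace H]
    [MeasurableSpace H] [BorelSpace H] [RKHS ℝ H (EuclideanSpace ℝ (Fin p)) ℝ]
    (hHK : IsRKHSOf H K)
    -- the stationary time series
    {Ω : Type*} [MeasurableSpace Ω] (Pr : Measure Ω) [IsProbabilityMeasure Pr]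
    (Y : ℤ → Ω → EuclideanSpace ℝ (Fin p)) (hY : ∀ i, Measurable (Y i))
    (hstat : IsStationaryProcess Y Pr)
    -- the null hypothesis: the marginal distribution is `P₀`, with mean embedding `μ₀`
    (P₀ : Measure (EuclideanSpace ℝ (Fin p))) [IsProbabilityMeasure P₀]
    (hH₀ : Pr.map (Y 1) = P₀)
    (μ₀ : H) (hμ₀ : IsMeanEmbedding P₀ μ₀)
    -- the functional central limit theorem, with a nondegenerate limit
    {Ω' : Type*} [MeasurableSpace Ω'] (Pr' : Measure Ω') [IsProbabilityMeasure Pr']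
    (W : Ω' → SkorokhodSpace H) (S : H →L[ℝ] H)
    (hFCLT : SatisfiesFCLT Y μ₀ Pr W S Pr') (hS : S ≠ 0)
    -- the splitting ratio
    (η : ℝ) (hη₀ : 0 < η) (hη₁ : η < 1)
    -- a standard Brownian motion
    {Ω'' : Type*} [MeasurableSpace Ω''] (Pr'' : Measure Ω'') [IsProbabilityMeasure Pr'']
    (B : I → Ω'' → ℝ) (hB : IsStandardBrownianMotion B Pr'') :
    TendstoInDistribution
      (fun (n : ℕ) ω => √(size₂ η n : ℝ) * statU (embedded Y μ₀ ω) η n) atTop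
      (limitU B) (fun _ => Pr) Pr'' := by
  have : SecondCountableTopology H := secondCountableTopology_of_kernel hK hHK
  have hX : ∀ i, Measurable fun ω => embedded Y μ₀ ω i := fun i =>
    ((continuous_kernelSection hK hHK).measurable.comp (hY i)).sub_const _
  have hstatU : ∀ n, Measurable fun ω => √(size₂ η n : ℝ) * statU (embedded Y μ₀ ω) η n :=
    fun n => (measurable_statU hX η n).const_mul _
  have hA := hFCLT.brownian.hasScaledBrownianIncrements_projPath hS hη₀ hη₁
  have hB' := hB.hasScaledBrownianIncrements
  have hBmeas : AEMeasurable (limitU B) Pr'' := hB'.aemeasurable_selfNormPath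
  -- Measurability is obtained from the variables X_i directly, without using that evaluation on the
  -- Skorokhod space is measurable.
  have hsteps : ∀ n, Measurable fun ω => selfNormRatio
      (projSteps η n (partialSumPath (embedded Y μ₀ ω) n)) (size₂ η n) := fun n => by
    have hV : ∀ s, Measurable fun ω => partialSumPath (embedded Y μ₀ ω) n s := fun s =>
      (Finset.measurable_sum _ fun i _ => hX _).const_smul _
    have hstep : ∀ t, Measurable fun ω =>
        projSteps η n (partialSumPath (embedded Y μ₀ ω) n) t := fun t =>
      (hV _).inner ((hV _).sub (hV _))
    exact (hstep _).div (((Finset.measurable_sum _ fun t _ =>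
      ((hstep t).sub ((hstep _).const_mul _)).pow_const 2).const_mul _).sqrt)
  have hlim := TendstoInDistribution.comp_of_tendsto hFCLT.tendsto
    (g := fun n v => selfNormRatio (projSteps η n v) (size₂ η n))
    (fun n => (hsteps n).aemeasurable) hA.aemeasurable_selfNormPath (by
      filter_upwards [hFCLT.brownian.continuous, hA.ae_integral_ne_zero] with ω hc hne
      exact tendsto_selfNormRatio_projSteps hη₀ hη₁ hc hne)
  refine ⟨fun n => (hstatU n).aemeasurable, hBmeas, ?_⟩
  have hlaw : Pr'.map (fun ω => selfNormPath fun s => projPath η (W ω) s)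
      = Pr''.map (limitU B) := hA.map_selfNormPath_eq hB'
  have h := hlim.tendsto
  simp_rw [hlaw] at h
  -- The functional agrees with the statistic once both blocks are nonempty, hence for all large n.
  refine h.congr' ?_
  filter_upwards [(tendsto_size₁ hη₀).eventually_gt_atTop 0,
    (tendsto_size₂ hη₀ hη₁).eventually_gt_atTop 0] with n hn₁ hn₂
  refine Subtype.ext ?_
  dsimp only
  congr 1
  funext ω
  exact (sqrt_size₂_mul_statU _ hη₀ hη₁ hn₁ hn₂).symm

end
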